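/- Let $C(\mathbb{Q})=\{(x,y)\in\mathbb{Q}^2 : x^2+y^2=1\}$. For $r\in\mathbb{Q}$, points $(x_1,y_1),\dots,(x_n,y_n)\in C(\mathbb{Q})$ are said to form an $r$-geometric progression sequence of length $n$ on $C$ if $x_{i-1}\neq 0$ and $x_i/x_{i-1}=r$ for every $i=2,\dots,n$. Then there are infinitely many rational numbers $s$ such that the point $$\left(\frac{2s}{1+s^2},\ \frac{1-s^2}{1+s^2}\right)\in C(\mathbb{Q})$$ lies in infinitely many geometric progression sequences on $C$ of length at least $3$ with pairwise distinct ratios; that is, for infinitely many $r\in\mathbb{Q}$ this point is a term of an $r$-geometric progression sequence of length at least $3$ on $C$. -/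

import Mathlib

/-- The set `C(ℚ)` of rational points on the unit circle `x² + y² = 1`. -/
def ratUnitCircle : Set (ℚ × ℚ) := {p | p.1 ^ 2 + p.2 ^ 2 = 1}

/-- The points `P 0, …, P (n - 1)` form an `r`-geometric progression sequence of length `n` on the
unit circle: all are rational points of the circle, and the quotient of consecutive abscissae is
defined (nonzero denominator) and equal to `r`. -/
def IsGeomProgSeq (r : ℚ) {n : ℕ} (P : Fin n → ℚ × ℚ) : Prop :=
  (∀ i, P i ∈ ratUnitCircle) ∧
    ∀ i j : Fin n, (i : ℕ) + 1 = (j : ℕ) → (P i).1 ≠ 0 ∧ (P j).1 / (P i).1 = r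

/-- The rational point of the unit circle with parameter `s`. -/
def circlePoint (s : ℚ) : ℚ × ℚ :=
  (2 * s / (1 + s ^ 2), (1 - s ^ 2) / (1 + s ^ 2))

/-! Put the point `(a, b)` in the middle of three terms: `a / r` and `a * r` must be abscissae, so
`1 - a²r²` and `r² - a²` must be squares. This is a genus one curve in `r`, related by
`mem_middleRatios` to the curve where `α² + 1` and `α² + a⁴` are squares. There, duplication from a
suitable seed doubles the 2-adic norm of `α`, giving infinitely many points with no rank or torsion
theory. Seeds exist for `a = (τ² - 1)/(1 + τ²)` when `1 + 3τ⁴` is a square, and the same 2-adic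
argument, starting from `τ = 2`, gives infinitely many such `τ`. -/

open Polynomial in
theorem finite_setOf_quartic_eq_zero {A B C D E : ℚ} (h : A ≠ 0 ∨ B ≠ 0) :
    {x : ℚ | A * x ^ 4 + B * x ^ 3 + C * x ^ 2 + D * x + E = 0}.Finite := by
  set p : ℚ[X] := Polynomial.C A * X ^ 4 + Polynomial.C B * X ^ 3 + Polynomial.C C * X ^ 2
    + Polynomial.C D * X + Polynomial.C E with hp
  have hp0 : p ≠ 0 := by
    intro h0
    have h4 : p.coeff 4 = A := by simp [hp]
    have h3 : p.coeff 3 = B := by simp [hp]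
    rw [h0, coeff_zero] at h3 h4
    rcases h with h | h
    · exact h h4.symm
    · exact h h3.symm
  refine (p.finite_setOfPred_isRoot hp0).subset fun x hx => ?_
  simpa [hp, IsRoot] using hx

theorem padicNorm_two_add_of_lt {x y : ℚ} (h : padicNorm 2 y < padicNorm 2 x) :
    padicNorm 2 (x + y) = padicNorm 2 x := by
  rw [padicNorm.add_eq_max_of_ne h.ne', max_eq_left h.le]

theorem padicNorm_two_sub_of_lt {x y : ℚ} (h : padicNorm 2 y < padicNorm 2 x) :
    padicNorm 2 (x - y) = padicNorm 2 x := by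
  rw [sub_eq_add_neg]
  exact padicNorm_two_add_of_lt (by rwa [padicNorm.neg])

theorem padicNorm_two_pow (x : ℚ) (n : ℕ) : padicNorm 2 (x ^ n) = padicNorm 2 x ^ n := by
  induction n with
  | zero => simp
  | succ n ih => rw [pow_succ, pow_succ, padicNorm.mul, ih]

theorem padicNorm_two_two : padicNorm 2 (2 : ℚ) = 1 / 2 := by
  have := padicNorm.padicNorm_p_of_prime (p := 2)
  norm_num at this ⊢
  exact this

theorem padicNorm_two_three : padicNorm 2 (3 : ℚ) = 1 := by
  have h : padicNorm 2 (1 + 2 : ℚ) = padicNorm 2 1 :=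
    padicNorm_two_add_of_lt (by rw [padicNorm_two_two, padicNorm.one]; norm_num)
  rwa [padicNorm.one, show (1 + 2 : ℚ) = 3 by norm_num] at h

theorem padicNorm_two_eq_of_sq_eq {x : ℚ} {y t : ℚ} (hy : 0 ≤ y)
    (h : x ^ 2 = t) (ht : padicNorm 2 t = y ^ 2) : padicNorm 2 x = y := by
  rw [← h, padicNorm_two_pow] at ht
  exact (pow_left_inj₀ (padicNorm.nonneg _) hy two_ne_zero).1 ht

/-! ### Duplication and 2-adic growth -/

/-- Abscissae of the doubles of rational points on `y² = x (x + 1) (x + c²)` are squares of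
elements of this set. -/
def doubleRoots (c : ℚ) : Set ℚ :=
  {α | ∃ β γ : ℚ, β ^ 2 = α ^ 2 + 1 ∧ γ ^ 2 = α ^ 2 + c ^ 2}

/-- Duplication formula at `x = α²`, `y = αβγ`: the double has abscissa `((x² - c²)/(2y))²`. -/
theorem doubleRoots_double {c α β γ : ℚ} (hβ : β ^ 2 = α ^ 2 + 1) (hγ : γ ^ 2 = α ^ 2 + c ^ 2)
    (h : α * β * γ ≠ 0) : (α ^ 4 - c ^ 2) / (2 * (α * β * γ)) ∈ doubleRoots c := by
  have key : (α * β * γ) ^ 2 = α ^ 2 * (α ^ 2 + 1) * (α ^ 2 + c ^ 2) := by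
    rw [← hβ, ← hγ]; ring
  refine ⟨(α ^ 4 + 2 * α ^ 2 + c ^ 2) / (2 * (α * β * γ)),
    (α ^ 4 + 2 * c ^ 2 * α ^ 2 + c ^ 2) / (2 * (α * β * γ)), ?_, ?_⟩
  · generalize α * β * γ = y at *
    field_simp
    linear_combination (-4) * key
  · generalize α * β * γ = y at *
    field_simp
    linear_combination (-4 * c ^ 2) * key

/-- Here `α`, `β`, `γ` have equal norm, so the factor 2 comes only from the `2` in the denominator
of the duplication formula. -/
theorem exists_doubleRoots_norm_of_one_lt {c α : ℚ} (hc : padicNorm 2 c = 1)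
    (hα : α ∈ doubleRoots c) (h1 : 1 < padicNorm 2 α) :
    ∃ α' ∈ doubleRoots c, padicNorm 2 α' = 2 * padicNorm 2 α := by
  obtain ⟨β, γ, hβ, hγ⟩ := hα
  have h2 : 1 < padicNorm 2 (α ^ 2) := by
    rw [padicNorm_two_pow]; exact one_lt_pow₀ h1 two_ne_zero
  have h4 : 1 < padicNorm 2 (α ^ 4) := by
    rw [padicNorm_two_pow]; exact one_lt_pow₀ h1 (by norm_num)
  have hc2 : padicNorm 2 (c ^ 2) = 1 := by rw [padicNorm_two_pow, hc, one_pow]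
  have nβ : padicNorm 2 β = padicNorm 2 α :=
    padicNorm_two_eq_of_sq_eq (by linarith) hβ
      (by rw [padicNorm_two_add_of_lt (by rwa [padicNorm.one]), padicNorm_two_pow])
  have nγ : padicNorm 2 γ = padicNorm 2 α :=
    padicNorm_two_eq_of_sq_eq (by linarith) hγ
      (by rw [padicNorm_two_add_of_lt (by rwa [hc2]), padicNorm_two_pow])
  have ny : padicNorm 2 (α * β * γ) = padicNorm 2 α ^ 3 := by
    rw [padicNorm.mul, padicNorm.mul, nβ, nγ]; ring
  have hy : α * β * γ ≠ 0 := by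
    intro h0
    rw [h0, padicNorm.zero] at ny
    have : 0 < padicNorm 2 α ^ 3 := by positivity
    linarith
  refine ⟨_, doubleRoots_double hβ hγ hy, ?_⟩
  rw [padicNorm.div, padicNorm.mul, ny, padicNorm_two_sub_of_lt (by rwa [hc2]),
    padicNorm_two_pow, padicNorm_two_two]
  have : padicNorm 2 α ≠ 0 := by linarith
  field_simp

/-- Now `β`, `γ` and `α⁴ - c²` are units, so the double has norm `2 / |α|`. -/
theorem exists_doubleRoots_one_lt_norm {c α : ℚ} (hc : padicNorm 2 c = 1)
    (hα : α ∈ doubleRoots c) (h0 : α ≠ 0) (h1 : padicNorm 2 α < 1) :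
    ∃ α' ∈ doubleRoots c, 1 < padicNorm 2 α' := by
  obtain ⟨β, γ, hβ, hγ⟩ := hα
  have hpos : 0 < padicNorm 2 α :=
    lt_of_le_of_ne (padicNorm.nonneg _) (padicNorm.nonzero h0).symm
  have h2 : padicNorm 2 (α ^ 2) < 1 := by
    rw [padicNorm_two_pow]; exact pow_lt_one₀ hpos.le h1 two_ne_zero
  have h4 : padicNorm 2 (α ^ 4) < 1 := by
    rw [padicNorm_two_pow]; exact pow_lt_one₀ hpos.le h1 (by norm_num)
  have hc2 : padicNorm 2 (c ^ 2) = 1 := by rw [padicNorm_two_pow, hc, one_pow]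
  have nβ : padicNorm 2 β = 1 :=
    padicNorm_two_eq_of_sq_eq zero_le_one hβ
      (by rw [add_comm, padicNorm_two_add_of_lt (by rwa [padicNorm.one]), padicNorm.one, one_pow])
  have nγ : padicNorm 2 γ = 1 :=
    padicNorm_two_eq_of_sq_eq zero_le_one hγ
      (by rw [add_comm, padicNorm_two_add_of_lt (by rwa [hc2]), hc2, one_pow])
  have ny : padicNorm 2 (α * β * γ) = padicNorm 2 α := by
    rw [padicNorm.mul, padicNorm.mul, nβ, nγ]; ring
  have hy : α * β * γ ≠ 0 := by
    intro h
    rw [h, padicNorm.zero] at ny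
    linarith
  refine ⟨_, doubleRoots_double hβ hγ hy, ?_⟩
  have e : padicNorm 2 (α ^ 4 - c ^ 2) = 1 := by
    rw [← neg_sub, padicNorm.neg, padicNorm_two_sub_of_lt (by rwa [hc2]), hc2]
  rw [padicNorm.div, padicNorm.mul, ny, e, padicNorm_two_two, lt_div_iff₀ (by linarith)]
  linarith

theorem doubleRoots_infinite {c α : ℚ} (hc : padicNorm 2 c = 1)
    (hα : α ∈ doubleRoots c) (h0 : α ≠ 0) (h1 : padicNorm 2 α < 1) :
    (doubleRoots c).Infinite := by
  intro hfin
  obtain ⟨α₁, hα₁, hn₁⟩ := exists_doubleRoots_one_lt_norm hc hα h0 h1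
  obtain ⟨m, hm, hmax⟩ := Set.exists_max_image _ (padicNorm 2) hfin ⟨_, hα₁⟩
  have hm1 := hn₁.trans_le (hmax _ hα₁)
  obtain ⟨m', hm', hn⟩ := exists_doubleRoots_norm_of_one_lt hc hm hm1
  have := hmax _ hm'
  linarith

/-! ### From points of the curve to ratios -/

/-- If `(a, b)` is on the circle, `a r` and `a / r` are abscissae of rational points of the circle
for every `r` in this set. -/
def middleRatios (a : ℚ) : Set ℚ :=
  {r | ∃ w z : ℚ, w ^ 2 = 1 - a ^ 2 * r ^ 2 ∧ z ^ 2 = r ^ 2 - a ^ 2}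

/-- As `α → ∞` the value tends to `±1`, the obvious ratios, for which `w² = z² = b²`. -/
theorem mem_middleRatios {a b α β γ : ℚ} (ha : a ≠ 0) (hab : a ^ 2 + b ^ 2 = 1)
    (hβ : β ^ 2 = α ^ 2 + 1) (hγ : γ ^ 2 = α ^ 2 + (a ^ 2) ^ 2) :
    (β * γ + b ^ 2 * α) / (α ^ 2 + a ^ 2) ∈ middleRatios a := by
  have hd : α ^ 2 + a ^ 2 ≠ 0 := by positivity
  have hb : b ^ 2 = 1 - a ^ 2 := by linarith
  have hβγ : (β * γ) ^ 2 = (α ^ 2 + 1) * (α ^ 2 + (a ^ 2) ^ 2) := by rw [← hβ, ← hγ]; ring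
  refine ⟨b * (α * γ - a ^ 2 * β) / (α ^ 2 + a ^ 2), b * (α * β + γ) / (α ^ 2 + a ^ 2), ?_, ?_⟩
  · rw [div_pow, mul_pow, hb, sub_sq, mul_pow, mul_pow, hγ, hβ]
    field_simp
    linear_combination a ^ 2 * hβγ
  · rw [div_pow, mul_pow, hb, add_sq, mul_pow, hγ, hβ]
    field_simp
    linear_combination -hβγ

theorem middleRatios_infinite {a b : ℚ} (ha : a ≠ 0) (hb : b ≠ 0) (hab : a ^ 2 + b ^ 2 = 1)
    (hinf : (doubleRoots (a ^ 2)).Infinite) : (middleRatios a).Infinite := by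
  intro hfin
  choose! β γ hβ hγ using fun α (h : α ∈ doubleRoots (a ^ 2)) => h
  -- Isolating `βγ` in the formula for `r` and squaring gives this quartic in `α`, so each `r` has
  -- finitely many preimages.
  refine hinf ((hfin.biUnion (t := fun r => {α : ℚ |
    (r ^ 2 - 1) * α ^ 4 + (-2 * r * b ^ 2) * α ^ 3
      + (2 * r ^ 2 * a ^ 2 + b ^ 4 - 1 - a ^ 4) * α ^ 2 + (-2 * r * a ^ 2 * b ^ 2) * α
      + (r ^ 2 * a ^ 4 - a ^ 4) = 0}) ?_).subset ?_)
  · intro r _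
    apply finite_setOf_quartic_eq_zero
    by_cases hr : r = 0
    · left; simp [hr]
    · right
      simp [hr, hb]
  · intro α hα
    have h1 := hβ α hα
    have h2 := hγ α hα
    refine Set.mem_biUnion (mem_middleRatios ha hab h1 h2) ?_
    have hd : α ^ 2 + a ^ 2 ≠ 0 := by positivity
    have h3 : (β α * γ α) ^ 2 = (α ^ 2 + 1) * (α ^ 2 + (a ^ 2) ^ 2) := by rw [← h1, ← h2]; ring
    set r := (β α * γ α + b ^ 2 * α) / (α ^ 2 + a ^ 2) with hr
    have h4 : r * (α ^ 2 + a ^ 2) - b ^ 2 * α = β α * γ α := by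
      rw [hr, div_mul_cancel₀ _ hd]; ring
    rw [← h4] at h3
    simp only [Set.mem_ofPred_eq]
    linear_combination h3

theorem exists_isGeomProgSeq {a b r : ℚ} (ha : a ≠ 0) (hab : a ^ 2 + b ^ 2 = 1)
    (hr : r ∈ middleRatios a) :
    ∃ P : Fin 3 → ℚ × ℚ, IsGeomProgSeq r P ∧ P 1 = (a, b) := by
  obtain ⟨w, z, hw, hz⟩ := hr
  have hr0 : r ≠ 0 := by
    rintro rfl
    have : 0 < a ^ 2 := by positivity
    nlinarith [sq_nonneg z]
  refine ⟨![(a / r, z / r), (a, b), (a * r, w)], ⟨?_, ?_⟩, rfl⟩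
  · intro i
    fin_cases i
    · simp only [ratUnitCircle, Set.mem_ofPred_eq]
      simp only [Fin.zero_eta, Matrix.cons_val_zero]
      field_simp
      linarith
    · simpa [ratUnitCircle] using hab
    · simp only [ratUnitCircle, Set.mem_ofPred_eq]
      simp only [Fin.reduceFinMk, Matrix.cons_val]
      linear_combination hw
  · intro i j hij
    fin_cases i <;> fin_cases j <;> simp at hij
    · refine ⟨div_ne_zero ha hr0, ?_⟩
      simp only [Fin.zero_eta, Fin.mk_one, Matrix.cons_val_zero, Matrix.cons_val_one]
      field_simp
    · refine ⟨ha, ?_⟩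
      simp only [Fin.reduceFinMk, Fin.mk_one, Matrix.cons_val]
      field_simp

/-! ### The family of admissible points -/

/-- Rational `τ ≠ 0` with `1 + 3 τ⁴` a square, in the 2-adic open unit disc. -/
def quarticPoints : Set ℚ :=
  {τ | τ ≠ 0 ∧ padicNorm 2 τ < 1 ∧ ∃ W : ℚ, W ^ 2 = 1 + 3 * τ ^ 4}

theorem padicNorm_three_mul_pow_four_lt {τ : ℚ} (h : padicNorm 2 τ < 1) :
    padicNorm 2 (3 * τ ^ 4) < 1 := by
  rw [padicNorm.mul, padicNorm_two_three, one_mul, padicNorm_two_pow]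
  exact pow_lt_one₀ (padicNorm.nonneg _) h (by norm_num)

theorem padicNorm_sqrt_quartic {τ W : ℚ} (h : padicNorm 2 τ < 1) (hW : W ^ 2 = 1 + 3 * τ ^ 4) :
    padicNorm 2 W = 1 :=
  padicNorm_two_eq_of_sq_eq zero_le_one hW (by
    rw [padicNorm_two_add_of_lt, padicNorm.one, one_pow]
    rw [padicNorm.one]
    exact padicNorm_three_mul_pow_four_lt h)

/-- Duplication on `W² = 1 + 3τ⁴` sends `τ` to `2τW/(1 - 3τ⁴)`, where `W` and the denominator are
2-adic units. -/
theorem exists_quarticPoints_norm {τ : ℚ} (hτ : τ ∈ quarticPoints) :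
    ∃ τ' ∈ quarticPoints, padicNorm 2 τ' = padicNorm 2 τ / 2 := by
  obtain ⟨h0, h1, W, hW⟩ := hτ
  have nW := padicNorm_sqrt_quartic h1 hW
  have nd : padicNorm 2 (1 - 3 * τ ^ 4) = 1 := by
    rw [padicNorm_two_sub_of_lt, padicNorm.one]
    rw [padicNorm.one]
    exact padicNorm_three_mul_pow_four_lt h1
  have hd : 1 - 3 * τ ^ 4 ≠ 0 := by
    intro h
    rw [h, padicNorm.zero] at nd
    norm_num at nd
  have hW0 : W ≠ 0 := by
    rintro rfl
    rw [padicNorm.zero] at nW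
    norm_num at nW
  have hn : padicNorm 2 (2 * τ * W / (1 - 3 * τ ^ 4)) = padicNorm 2 τ / 2 := by
    rw [padicNorm.div, padicNorm.mul, padicNorm.mul, nW, nd, padicNorm_two_two]
    ring
  refine ⟨_, ⟨by positivity, ?_, ((1 - 3 * τ ^ 4) ^ 2 + 24 * τ ^ 4) / (1 - 3 * τ ^ 4) ^ 2, ?_⟩, hn⟩
  · rw [hn]
    have := padicNorm.nonneg (p := 2) τ
    linarith
  · have hW4 : W ^ 4 = (1 + 3 * τ ^ 4) ^ 2 := by rw [← hW]; ring
    rw [div_pow, div_pow, mul_pow, mul_pow, hW4]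
    field_simp
    ring

theorem quarticPoints_infinite : quarticPoints.Infinite := by
  intro hfin
  have h2 : (2 : ℚ) ∈ quarticPoints :=
    ⟨two_ne_zero, by rw [padicNorm_two_two]; norm_num, 7, by norm_num⟩
  obtain ⟨m, hm, hmin⟩ := Set.exists_min_image _ (padicNorm 2) hfin ⟨_, h2⟩
  obtain ⟨m', hm', hn⟩ := exists_quarticPoints_norm hm
  have := hmin _ hm'
  have : 0 < padicNorm 2 m :=
    lt_of_le_of_ne (padicNorm.nonneg _) (padicNorm.nonzero hm.1).symm
  linarith

theorem doubleRoots_infinite_of_quarticPoints {τ : ℚ} (hτ : τ ∈ quarticPoints) :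
    (doubleRoots (((τ ^ 2 - 1) / (1 + τ ^ 2)) ^ 2)).Infinite ∧
      padicNorm 2 ((τ ^ 2 - 1) / (1 + τ ^ 2)) = 1 := by
  obtain ⟨h0, h1, W, hW⟩ := hτ
  have nW := padicNorm_sqrt_quartic h1 hW
  have h2 : padicNorm 2 (τ ^ 2) < 1 := by
    rw [padicNorm_two_pow]; exact pow_lt_one₀ (padicNorm.nonneg _) h1 two_ne_zero
  have nD : padicNorm 2 (1 + τ ^ 2) = 1 := by
    rw [padicNorm_two_add_of_lt, padicNorm.one]
    rwa [padicNorm.one]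
  have nM : padicNorm 2 (τ ^ 2 - 1) = 1 := by
    rw [← neg_sub, padicNorm.neg, padicNorm_two_sub_of_lt, padicNorm.one]
    rwa [padicNorm.one]
  have hM : τ ^ 2 - 1 ≠ 0 := by
    intro h
    rw [h, padicNorm.zero] at nM
    norm_num at nM
  have hW0 : W ≠ 0 := by
    rintro rfl
    rw [padicNorm.zero] at nW
    norm_num at nW
  have hD : 1 + τ ^ 2 ≠ 0 := by positivity
  have na : padicNorm 2 ((τ ^ 2 - 1) / (1 + τ ^ 2)) = 1 := by
    rw [padicNorm.div, nD, nM, div_one]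
  -- The seed: `W² = 1 + 3τ⁴` is what makes both sums squares, and its norm is `|τ|² < 1`.
  refine ⟨doubleRoots_infinite (α := (τ ^ 2 - 1) * τ ^ 2 / ((1 + τ ^ 2) * W)) ?_ ?_ ?_ ?_, na⟩
  · rw [padicNorm_two_pow, na, one_pow]
  · refine ⟨(2 * τ ^ 4 + τ ^ 2 + 1) / ((1 + τ ^ 2) * W),
      (τ ^ 2 - 1) * (2 * τ ^ 4 - τ ^ 2 + 1) / ((1 + τ ^ 2) ^ 2 * W), ?_, ?_⟩
    · rw [div_pow, div_pow, mul_pow _ W, hW]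
      have : 1 + 3 * τ ^ 4 ≠ 0 := by positivity
      field_simp
      ring
    · rw [div_pow, div_pow, mul_pow _ W, mul_pow _ W, hW]
      have : 1 + 3 * τ ^ 4 ≠ 0 := by positivity
      field_simp
      ring
  · exact div_ne_zero (mul_ne_zero hM (pow_ne_zero _ h0)) (mul_ne_zero hD hW0)
  · rw [padicNorm.div, padicNorm.mul, padicNorm.mul, nM, nD, nW]
    simpa using h2

theorem mainTheorem2 :
    {s : ℚ | {r : ℚ | ∃ (n : ℕ) (P : Fin n → ℚ × ℚ),
      3 ≤ n ∧ IsGeomProgSeq r P ∧ ∃ i, P i = circlePoint s}.Infinite}.Infinite := by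
  have hne : ∀ τ ∈ quarticPoints, τ + 1 ≠ 0 := by
    intro τ hτ h
    have h1 := hτ.2.1
    rw [eq_neg_of_add_eq_zero_left h, padicNorm.neg, padicNorm.one] at h1
    exact lt_irrefl _ h1
  have hinj : Set.InjOn (fun τ : ℚ => (τ - 1) / (τ + 1)) quarticPoints := by
    intro x hx y hy hxy
    have hx' := hne x hx
    have hy' := hne y hy
    simp only at hxy
    rw [div_eq_div_iff hx' hy'] at hxy
    linarith
  refine (quarticPoints_infinite.image hinj).mono ?_
  rintro _ ⟨τ, hτ, rfl⟩
  obtain ⟨hinf, na⟩ := doubleRoots_infinite_of_quarticPoints hτ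
  have hD : 1 + τ ^ 2 ≠ 0 := by positivity
  have hτ1 := hne τ hτ
  have hcp : circlePoint ((τ - 1) / (τ + 1)) =
      ((τ ^ 2 - 1) / (1 + τ ^ 2), 2 * τ / (1 + τ ^ 2)) := by
    have h : 1 + ((τ - 1) / (τ + 1)) ^ 2 = 2 * (1 + τ ^ 2) / (τ + 1) ^ 2 := by
      field_simp
      ring
    rw [circlePoint, h]
    ext
    · simp only
      field_simp
      ring
    · simp only
      field_simp
      ring
  have ha : (τ ^ 2 - 1) / (1 + τ ^ 2) ≠ 0 := by
    intro h
    rw [h, padicNorm.zero] at na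
    norm_num at na
  have hb : 2 * τ / (1 + τ ^ 2) ≠ 0 := div_ne_zero (mul_ne_zero two_ne_zero hτ.1) hD
  have hab : ((τ ^ 2 - 1) / (1 + τ ^ 2)) ^ 2 + (2 * τ / (1 + τ ^ 2)) ^ 2 = 1 := by
    field_simp
    ring
  refine (middleRatios_infinite ha hb hab hinf).mono fun r hr => ?_
  obtain ⟨P, hP, hP1⟩ := exists_isGeomProgSeq ha hab hr
  exact ⟨3, P, le_rfl, hP, 1, by rw [hP1, hcp]⟩
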